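/- For $n\ge 1$ let $C_n\subset S_n$ be the cyclic group generated by an $n$-cycle $c$, and for an integer $r$ let $\exp(\frac{2\pi i}{n}r){\uparrow}_{C_n}^{S_n}$ be the complex representation of $S_n$ induced from the one-dimensional representation of $C_n$ in which $c$ acts as multiplication by $\exp(2\pi i r/n)$. Let $\mathrm{ch}$ be the Frobenius characteristic, $\mathrm{ch}(V)=\frac1{n!}\sum_{\sigma\in S_n}\mathrm{tr}_V(\sigma)\,p_{\lambda(\sigma)}$, where $p_\lambda$ is the power-sum symmetric function and $\lambda(\sigma)$ is the cycle type of $\sigma$. Put * $Lie_n=\mathrm{ch}\big(\exp(\frac{2\pi i}{n}){\uparrow}_{C_n}^{S_n}\big)$; * $Conj_n=\mathrm{ch}$ of the permutation representation of $S_n$ given by its conjugation action on the class of $n$-cycles; * $Lie_n^{(q)}=\mathrm{ch}\big(\exp(\frac{2\pi i}{n}q^{k}){\uparrow}_{C_n}^{S_n}\big)$ for a prime $q$, where $q^k$ is the highest power of $q$ dividing $n$; and $Lie=\sum_{n\ge1}Lie_n$, $Conj=\sum_{n\ge1}Conj_n$, $Lie^{(q)}=\sum_{n\ge1}Lie^{(q)}_n$,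 as formal sums of symmetric functions. Write $p_k[F]=F[p_k]=F(x_1^k,x_2^k,\ldots)$ for plethysm with the power sum $p_k$, and $\mu$ for the number-theoretic Möbius function. A (formal sum of) symmetric function(s) is Schur-positive if each homogeneous component is a linear combination with nonnegative integer coefficients of Schur functions, i.e. of Frobenius characteristics of irreducible complex representations of the symmetric group. **Theorem.** 1. $Conj=\sum_{k\ge1}p_k[Lie]$, and hence the sum on the right is Schur-positive. Equivalently, $Lie=\sum_{k\ge1}\mu(k)\,p_k[Conj]$. 2. $Conj=\sum_{k\ge1}p_{2k-1}[Lie^{(2)}]$, and hence the sum on the right is Schur-positive. Equivalently, $Lie^{(2)}=\sum_{k\ge1}\mu(2k-1)\,p_{2k-1}[Conj]$. 3. For every prime $q$, $Conj=\sum_{n\ge1,\ q\nmid n}p_n[Lie^{(q)}]$, and hence the sum on the right is Schur-positive. 4. For every integer $q\ge2$, $Conj=\sum_{n\ge1,\ q\nmid n}p_n\big[\sum_{k\ge0}Lie[p_{q^k}]\big]$. -/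

import Mathlib

noncomputable section

namespace SymPleth

open MvPowerSeries

/-- The ambient ring of formal power series over `ℂ` in the variables `x₀, x₁, x₂, …`.  It contains
the completion `∏ₙ Λⁿ` of the ring of symmetric functions. -/
abbrev Series : Type := MvPowerSeries ℕ ℂ

/-- The power sum `p_k = ∑ᵢ xᵢ ^ k`, for `k ≥ 1`. -/
def powerSum (k : ℕ) : Series := by
  classical exact fun d => if ∃ i : ℕ, d = Finsupp.single i k then 1 else 0

/-- `F` is the sum of the family `f` of formal power series: every monomial occurs in only finitely
many of the `f i`, and its coefficient in `F` is the sum of its coefficients in the `f i`. -/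
def HasFormalSum {ι : Type} (f : ι → Series) (F : Series) : Prop :=
  ∀ d : ℕ →₀ ℕ, {i | coeff d (f i) ≠ 0}.Finite ∧ coeff d F = ∑ᶠ i, coeff d (f i)

/-- The formal sum of a family; it is meaningful when `HasFormalSum f (formalSum f)`. -/
def formalSum {ι : Type} (f : ι → Series) : Series := fun d => ∑ᶠ i, coeff d (f i)

/-- The plethysm `p_k[F] = F[p_k] = F(x₀ ^ k, x₁ ^ k, …)` for `k ≥ 1`. -/
def powerPleth (k : ℕ+) (F : Series) : Series := expand (k : ℕ) k.ne_zero F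

/-- The Frobenius characteristic of a complex representation `ρ` of the group of permutations of a
set of `n` elements: `ch ρ = (1 / n!) ∑_σ tr (ρ σ) p_{λ(σ)}`, where `λ(σ)` is the cycle type of `σ`,
with fixed points as parts equal to 1, and `p_λ` is the product of the `p_{λᵢ}`. -/
def frobChar {α : Type} [Fintype α] [DecidableEq α] {V : Type} [AddCommGroup V] [Module ℂ V]
    (ρ : Representation ℂ (Equiv.Perm α) V) : Series :=
  (((Fintype.card α).factorial : ℂ)⁻¹) • ∑ σ : Equiv.Perm α,
    LinearMap.trace ℂ V (ρ σ) • ((Equiv.Perm.partition σ).parts.map powerSum).prod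

/-- The Schur functions of degree `n`: the Frobenius characteristics of the irreducible complex
representations of `S_n`. -/
def schurFunctions (n : ℕ) : Set Series :=
  {s | ∃ (V : Type) (_ : AddCommGroup V) (_ : Module ℂ V) (_ : FiniteDimensional ℂ V)
    (ρ : Representation ℂ (Equiv.Perm (Fin n)) V), ρ.IsIrreducible ∧ s = frobChar ρ}

/-- `F` is Schur-positive: for every `n`, its component of degree `n` is a (finite) linear
combination of Schur functions of degree `n` with nonnegative integer coefficients. -/
def SchurPositive (F : Series) : Prop :=
  ∀ n : ℕ, homogeneousComponent n F ∈ AddSubmonoid.closure (schurFunctions n)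

/-- The `n`-cycles among the permutations of a set of `n` elements (a single cycle through all the
points; for `n = 1` this is the identity). -/
def FullCycle (α : Type) : Type := {τ : Equiv.Perm α // τ.IsCycleOn Set.univ}

/-- The conjugacy action of the symmetric group on the class of `n`-cycles. -/
instance (α : Type) : MulAction (Equiv.Perm α) (FullCycle α) where
  smul σ τ := ⟨σ * τ.1 * σ⁻¹, by simpa using τ.2.conj (g := σ)⟩
  one_smul τ := Subtype.ext (by change 1 * τ.1 * 1⁻¹ = τ.1; simp)
  mul_smul σ π τ := Subtype.ext (by
    change (σ * π) * τ.1 * (σ * π)⁻¹ = σ * (π * τ.1 * π⁻¹) * σ⁻¹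
    simp [mul_assoc])

/-- `Conj_n`: the (Frobenius characteristic of the) permutation representation of `S_n` afforded by
the conjugacy action on the class of `n`-cycles. -/
def conjPart (n : ℕ+) : Series :=
  frobChar (Representation.ofMulAction ℂ (Equiv.Perm (Fin n)) (FullCycle (Fin n)))

/-- The cyclic group `C_n`, as the group of translations of `ℤ/n`: the homomorphism sends the
generator `1` to the `n`-cycle `x ↦ x + 1`. -/
def cyclicHom (n : ℕ+) : Multiplicative (ZMod n) →* Equiv.Perm (ZMod n) where
  toFun a := Equiv.addLeft a.toAdd
  map_one' := by ext x; simp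
  map_mul' a b := by ext x; simp

/-- The one-dimensional representation `exp (2πi r / n)` of `C_n`: the generator acts on `ℂ` as
multiplication by `exp (2πi r / n)`, and the element `a` as multiplication by
`exp (2πi r a / n)`. -/
def cyclicChar (n : ℕ+) (r : ℕ) : Representation ℂ (Multiplicative (ZMod n)) ℂ where
  toFun a := (ZMod.stdAddChar ((r : ZMod n) * a.toAdd)) • LinearMap.id
  map_one' := by ext; simp
  map_mul' a b := by ext; simp [mul_add, AddChar.map_add_eq_mul, mul_comm]

/-- `ℓ_n^{(r)}`: the Frobenius characteristic of the representation of `S_n` (the permutations of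
`ℤ/n`) induced from the representation `exp (2πi r / n)` of `C_n`. -/
def foulkes (n : ℕ+) (r : ℕ) : Series :=
  frobChar (Representation.ind (cyclicHom n) (cyclicChar n r))

/-- `Lie_n = ch (exp (2πi / n) ↑ S_n)`. -/
def liePart (n : ℕ+) : Series := foulkes n 1

/-- `Lie_n^{(q)} = ch (exp (2πi q^k / n) ↑ S_n)`, where `q^k` is the highest power of the prime `q`
dividing `n`. -/
def lieVariantPart (q : ℕ) (n : ℕ+) : Series := foulkes n (q ^ padicValNat q n)

/-- `Conj = ∑_{n ≥ 1} Conj_n`. -/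
def Conj : Series := formalSum conjPart

/-- `Lie = ∑_{n ≥ 1} Lie_n`. -/
def Lie : Series := formalSum liePart

/-- `Lie^{(q)} = ∑_{n ≥ 1} Lie_n^{(q)}`. -/
def LieVariant (q : ℕ) : Series := formalSum (lieVariantPart q)

end SymPleth

end

/-!
Put `L = -log (1 - p_1)` and, for an arithmetic function `a`, let `D_a F = ∑_k a(k) p_k[F]`. Since
`p_k[p_l[F]] = p_{kl}[F]`, these operators compose by Dirichlet convolution: `D_b D_a = D_{b * a}`.

By the formula for induced characters, `ch (exp (2πi r / n) ↑ S_n)` is the degree `n` part of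
`D_a L` as soon as `d a(d)` is the Ramanujan sum `c_d(r)` for all `d ∣ n`; and `∑_{e ∣ d} c_e(r)` is
`d` or `0` according to whether `d ∣ r`. The conjugation action on the `n`-cycles is the case
`r = 0`, as `C_n` is the stabilizer of an `n`-cycle. Möbius inversion gives `Lie = D_a L`,
`Conj = D_{ζ * a} L` and `Lie^{(q)} = D_{π * a} L`, where `a(d) = μ(d) / d` and `π` is the indicator
function of the powers of `q`.

The theorem thus reduces to the identities `μ * ζ = 1`, `χ * π = ζ` and `(χ μ) * χ = 1`, where `χ`
is the indicator function of the integers not divisible by `q`.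
-/

noncomputable section

namespace SymPleth

open MvPowerSeries ArithmeticFunction
open scoped ArithmeticFunction.Moebius ArithmeticFunction.zeta MonoidAlgebra

section FormalSum

variable {ι κ : Type}

lemma HasFormalSum.formalSum_eq {f : ι → Series} {F : Series} (h : HasFormalSum f F) :
    formalSum f = F :=
  MvPowerSeries.ext fun d => ((h d).2).symm

lemma HasFormalSum.comp_injective {f : κ → Series} {F : Series} (h : HasFormalSum f F)
    {s : ι → κ} (hs : s.Injective) (hf : ∀ k ∉ Set.range s, f k = 0) :
    HasFormalSum (f ∘ s) F := by
  refine fun d => ⟨(h d).1.preimage hs.injOn, ?_⟩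
  have hsupp (k : κ) (hk : coeff d (f k) ≠ 0) : k ∈ Set.univ ↔ k ∈ Set.range s :=
    ⟨fun _ => by_contra fun hks => hk (by rw [hf k hks, _root_.map_zero]), fun _ => trivial⟩
  rw [(h d).2, ← finsum_mem_univ, finsum_mem_inter_support_eq' _ _ _ hsupp, finsum_mem_range hs]
  rfl

section Homogeneous

variable {f : ℕ+ → Series} (hf : ∀ n : ℕ+, (f n).IsHomogeneous n)

include hf

lemma hasFormalSum_formalSum_of_isHomogeneous : HasFormalSum f (formalSum f) := by
  refine fun d => ⟨Set.Subsingleton.finite fun m hm n hn => PNat.coe_injective ?_, rfl⟩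
  exact (not_imp_comm.1 (IsHomogeneous.coeff_eq_zero (hf m)) hm).symm.trans
    (not_imp_comm.1 (IsHomogeneous.coeff_eq_zero (hf n)) hn)

lemma coeff_formalSum_of_isHomogeneous {d : ℕ →₀ ℕ} {n : ℕ+} (hd : d.degree = n) :
    coeff d (formalSum f) = coeff d (f n) :=
  finsum_eq_single _ n fun _ hm =>
    IsHomogeneous.coeff_eq_zero (hf _) fun h => hm (PNat.coe_injective (h.symm.trans hd))

lemma constantCoeff_formalSum_of_isHomogeneous : constantCoeff (formalSum f) = 0 :=
  finsum_eq_zero_of_forall_eq_zero fun n =>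
    IsHomogeneous.coeff_eq_zero (hf n) (by simpa using n.ne_zero.symm)

lemma homogeneousComponent_formalSum_of_isHomogeneous (n : ℕ+) :
    homogeneousComponent n (formalSum f) = f n := by
  ext d
  rw [coeff_homogeneousComponent]
  split_ifs with hd
  · exact coeff_formalSum_of_isHomogeneous hf hd
  · exact (IsHomogeneous.coeff_eq_zero (hf n) hd).symm

lemma schurPositive_formalSum (h : ∀ n : ℕ+, f n ∈ AddSubmonoid.closure (schurFunctions n)) :
    SchurPositive (formalSum f) := by
  intro n
  rcases n.eq_zero_or_pos with rfl | hn
  · have : homogeneousComponent 0 (formalSum f) = 0 := by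
      ext d
      rw [coeff_homogeneousComponent, _root_.map_zero]
      split_ifs with hd
      · rw [(Finsupp.degree_eq_zero_iff d).1 hd]
        exact constantCoeff_formalSum_of_isHomogeneous hf
      · rfl
    exact this ▸ zero_mem _
  · lift n to ℕ+ using hn
    exact homogeneousComponent_formalSum_of_isHomogeneous hf n ▸ h n

end Homogeneous

end FormalSum

section Plethysm

variable (k l : ℕ+) (F : Series)

lemma coeff_smul_powerPleth (e : ℕ →₀ ℕ) :
    coeff ((k : ℕ) • e) (powerPleth k F) = coeff e F :=
  coeff_expand_smul _ _ _ _

variable {k} in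
lemma coeff_powerPleth_eq_zero {d : ℕ →₀ ℕ} (h : ∀ e : ℕ →₀ ℕ, (k : ℕ) • e ≠ d) :
    coeff d (powerPleth k F) = 0 := by
  obtain ⟨i, hi⟩ : ∃ i, ¬ (k : ℕ) ∣ d i := by
    by_contra! hdvd
    refine h (d.mapRange (· / (k : ℕ)) (Nat.zero_div _)) (Finsupp.ext fun i => ?_)
    simp [Nat.mul_div_cancel' (hdvd i)]
  exact coeff_expand_of_not_dvd _ _ _ hi

lemma powerPleth_one : powerPleth 1 F = F :=
  expand_one_apply F

lemma powerPleth_powerPleth : powerPleth k (powerPleth l F) = powerPleth (k * l) F :=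
  (expand_mul (k : ℕ) k.ne_zero (l : ℕ) l.ne_zero F).symm

lemma coeff_powerSum (n : ℕ) (d : ℕ →₀ ℕ) [Decidable (∃ i, d = Finsupp.single i n)] :
    coeff d (powerSum n) = if ∃ i, d = Finsupp.single i n then 1 else 0 := by
  rw [coeff_apply, powerSum]
  congr

lemma powerPleth_powerSum (n : ℕ) : powerPleth k (powerSum n) = powerSum (k * n) := by
  classical
  have hsingle (i : ℕ) : Finsupp.single i ((k : ℕ) * n) = (k : ℕ) • Finsupp.single i n := by
    rw [Finsupp.smul_single, smul_eq_mul]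
  ext d
  by_cases h : ∃ e : ℕ →₀ ℕ, (k : ℕ) • e = d
  · obtain ⟨e, rfl⟩ := h
    simp only [coeff_smul_powerPleth, coeff_powerSum, hsingle, nsmul_right_inj k.ne_zero]
  · push Not at h
    rw [coeff_powerPleth_eq_zero _ h, coeff_powerSum, if_neg]
    rintro ⟨i, rfl⟩
    exact h _ (hsingle i).symm

variable {F} in
lemma mem_divisors_of_coeff_powerPleth_ne_zero (hF : constantCoeff F = 0)
    {d : ℕ →₀ ℕ} (h : coeff d (powerPleth k F) ≠ 0) : (k : ℕ) ∈ d.degree.divisors := by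
  obtain ⟨e, rfl⟩ : ∃ e : ℕ →₀ ℕ, (k : ℕ) • e = d := by
    by_contra! hd
    exact h (coeff_powerPleth_eq_zero F hd)
  rw [coeff_smul_powerPleth] at h
  have he : e.degree ≠ 0 := fun he => h (by rwa [(Finsupp.degree_eq_zero_iff e).1 he])
  simpa using he

end Plethysm

section Homogeneity

lemma isHomogeneous_sum_smul {ι : Type} {s : Finset ι} (c : ι → ℂ) {f : ι → Series} {n : ℕ}
    (hf : ∀ i ∈ s, (f i).IsHomogeneous n) : (∑ i ∈ s, c i • f i).IsHomogeneous n := by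
  rw [isHomogeneous_iff_eq_homogeneousComponent, map_sum]
  refine Finset.sum_congr rfl fun i hi => ?_
  rw [map_smul, ← isHomogeneous_iff_eq_homogeneousComponent.1 (hf i hi)]

lemma isHomogeneous_smul (c : ℂ) {F : Series} {n : ℕ} (hF : F.IsHomogeneous n) :
    (c • F).IsHomogeneous n := by
  rw [isHomogeneous_iff_eq_homogeneousComponent] at hF ⊢
  rw [map_smul, ← hF]

lemma isHomogeneous_powerSum (k : ℕ) : (powerSum k).IsHomogeneous k := by
  classical
  intro d hd
  rw [coeff_powerSum, ne_eq, ite_eq_right_iff, Classical.not_imp] at hd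
  obtain ⟨⟨i, rfl⟩, -⟩ := hd
  simp [Finsupp.weight_single]

lemma isHomogeneous_prod_powerSum (s : Multiset ℕ) :
    (s.map powerSum).prod.IsHomogeneous s.sum := by
  induction s using Multiset.induction_on with
  | empty =>
    classical
    intro d hd
    rw [Multiset.map_zero, Multiset.prod_zero, coeff_one, ne_eq, ite_eq_right_iff,
      Classical.not_imp] at hd
    simp [hd.1]
  | cons k s ih =>
    rw [Multiset.map_cons, Multiset.prod_cons, Multiset.sum_cons]
    exact IsHomogeneous.mul (isHomogeneous_powerSum k) ih

end Homogeneity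

section PlethysticSum

/-- `G = ∑_{k ≥ 1} a(k) p_k[F]` as a formal sum. Composing two such operators on series
convolves their coefficient functions, see `HasPlethysticSum.of_mul`. -/
def HasPlethysticSum (a : ArithmeticFunction ℂ) (F G : Series) : Prop :=
  HasFormalSum (fun k : ℕ+ => a k • powerPleth k F) G

variable {a b : ArithmeticFunction ℂ} {F G H : Series}

lemma hasPlethysticSum_iff (hF : constantCoeff F = 0) :
    HasPlethysticSum a F G ↔ ∀ d : ℕ →₀ ℕ,
      coeff d G = ∑ k ∈ d.degree.divisors, a k * coeff d (powerPleth k.toPNat' F) := by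
  refine forall_congr' fun d => ?_
  have hsupp : (Function.support fun k : ℕ+ => coeff d (a k • powerPleth k F)) ⊆
      d.degree.divisors.preimage PNat.val PNat.coe_injective.injOn := fun k hk => by
    rw [Function.mem_support, coeff_smul] at hk
    rw [Finset.coe_preimage]
    exact mem_divisors_of_coeff_powerPleth_ne_zero k hF (right_ne_zero_of_mul hk)
  refine (and_iff_right ((Finset.finite_toSet _).subset hsupp)).trans ?_
  rw [finsum_eq_sum_of_support_subset _ hsupp, ← Finset.sum_preimage PNat.val _
    PNat.coe_injective.injOn fun k => a k * coeff d (powerPleth k.toPNat' F)]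
  · simp only [coeff_smul, PNat.coe_toPNat']
  · exact fun k hk hk' => absurd ⟨⟨k, Nat.pos_of_mem_divisors hk⟩, rfl⟩ hk'

lemma exists_hasPlethysticSum (a : ArithmeticFunction ℂ) (hF : constantCoeff F = 0) :
    ∃ G, HasPlethysticSum a F G :=
  ⟨fun d => ∑ k ∈ d.degree.divisors, a k * coeff d (powerPleth k.toPNat' F),
    (hasPlethysticSum_iff hF).2 fun _ => rfl⟩

lemma HasPlethysticSum.constantCoeff_eq_zero (h : HasPlethysticSum a F G)
    (hF : constantCoeff F = 0) : constantCoeff G = 0 := by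
  simpa using (hasPlethysticSum_iff hF).1 h 0

lemma hasPlethysticSum_one (hF : constantCoeff F = 0) : HasPlethysticSum 1 F F := by
  refine (hasPlethysticSum_iff hF).2 fun d => ?_
  rcases eq_or_ne d.degree 0 with hd | hd
  · rw [(Finsupp.degree_eq_zero_iff d).1 hd]
    simpa using hF
  · rw [Finset.sum_eq_single_of_mem 1 (by simpa using hd) fun k _ hk => by
      rw [one_apply_ne hk, zero_mul], one_one, one_mul]
    exact congrArg (coeff d) (powerPleth_one F).symm

lemma HasPlethysticSum.coeff_powerPleth (h : HasPlethysticSum a F G) (hF : constantCoeff F = 0)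
    (k : ℕ+) (d : ℕ →₀ ℕ) :
    coeff d (powerPleth k G) =
      ∑ l ∈ (d.degree / k).divisors, a l * coeff d (powerPleth (k * l.toPNat') F) := by
  by_cases hd : ∃ e : ℕ →₀ ℕ, (k : ℕ) • e = d
  · obtain ⟨e, rfl⟩ := hd
    rw [coeff_smul_powerPleth, (hasPlethysticSum_iff hF).1 h, map_nsmul, smul_eq_mul,
      Nat.mul_div_cancel_left _ k.pos]
    simp only [← powerPleth_powerPleth, coeff_smul_powerPleth]
  · push Not at hd
    rw [coeff_powerPleth_eq_zero _ hd]
    simp only [← powerPleth_powerPleth, coeff_powerPleth_eq_zero _ hd, mul_zero,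
      Finset.sum_const_zero]

lemma sum_divisors_sum_divisorsAntidiagonal {M : Type*} [AddCommMonoid M] (N : ℕ)
    (f : ℕ → ℕ → M) :
    ∑ n ∈ N.divisors, ∑ x ∈ n.divisorsAntidiagonal, f x.1 x.2 =
      ∑ k ∈ N.divisors, ∑ l ∈ (N / k).divisors, f k l := by
  rw [Finset.sum_sigma', Finset.sum_sigma']
  refine Finset.sum_nbij' (fun x => ⟨x.2.1, x.2.2⟩) (fun y => ⟨y.1 * y.2, y.1, y.2⟩) ?_ ?_ ?_ ?_ ?_
  · rintro ⟨_, k, l⟩ hx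
    simp only [Finset.mem_sigma, Nat.mem_divisors, Nat.mem_divisorsAntidiagonal] at hx ⊢
    obtain ⟨⟨hN, hN0⟩, rfl, -⟩ := hx
    obtain ⟨m, rfl⟩ := hN
    simp_all [mul_assoc]
  · rintro ⟨k, l⟩ hx
    simp only [Finset.mem_sigma, Nat.mem_divisors, Nat.mem_divisorsAntidiagonal] at hx ⊢
    obtain ⟨⟨⟨m, rfl⟩, hN0⟩, hl, hl0⟩ := hx
    have hk : 0 < k := Nat.pos_of_ne_zero (left_ne_zero_of_mul hN0)
    rw [Nat.mul_div_cancel_left _ hk] at hl hl0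
    simp [mul_dvd_mul_left, hN0, hl, ne_zero_of_dvd_ne_zero hl0 hl, hk.ne']
  all_goals simp +contextual

/-- Dirichlet convolution of coefficient functions is composition of operators because
`p_k[p_l[F]] = p_{kl}[F]`. -/
lemma HasPlethysticSum.of_mul (hF : constantCoeff F = 0) (hG : HasPlethysticSum a F G)
    (hH : HasPlethysticSum (b * a) F H) : HasPlethysticSum b G H := by
  rw [hasPlethysticSum_iff (hG.constantCoeff_eq_zero hF)]
  intro d
  calc coeff d H
      = ∑ n ∈ d.degree.divisors, ∑ x ∈ n.divisorsAntidiagonal,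
          b x.1 * (a x.2 * coeff d (powerPleth (x.1 * x.2).toPNat' F)) := by
        rw [(hasPlethysticSum_iff hF).1 hH]
        refine Finset.sum_congr rfl fun n _ => ?_
        rw [mul_apply, Finset.sum_mul]
        refine Finset.sum_congr rfl fun x hx => ?_
        rw [(Nat.mem_divisorsAntidiagonal.1 hx).1, mul_assoc]
    _ = ∑ k ∈ d.degree.divisors, ∑ l ∈ (d.degree / k).divisors,
          b k * (a l * coeff d (powerPleth (k * l).toPNat' F)) :=
        sum_divisors_sum_divisorsAntidiagonal _
          fun k l => b k * (a l * coeff d (powerPleth (k * l).toPNat' F))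
    _ = ∑ k ∈ d.degree.divisors, b k * coeff d (powerPleth k.toPNat' G) := by
        refine Finset.sum_congr rfl fun k hk => ?_
        lift k to ℕ+ using Nat.pos_of_mem_divisors hk
        rw [PNat.coe_toPNat', hG.coeff_powerPleth hF, Finset.mul_sum]
        refine Finset.sum_congr rfl fun l hl => ?_
        lift l to ℕ+ using Nat.pos_of_mem_divisors hl
        rw [← PNat.mul_coe, PNat.coe_toPNat', PNat.coe_toPNat']

lemma HasPlethysticSum.comp_injective {ι : Type} (h : HasPlethysticSum a F G) {s : ι → ℕ+}
    (hs : s.Injective) (ha : ∀ k ∉ Set.range s, a k = 0) :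
    HasFormalSum (fun i => a (s i) • powerPleth (s i) F) G :=
  HasFormalSum.comp_injective h hs fun k hk => by rw [ha k hk, zero_smul]

end PlethysticSum

section Dirichlet

lemma pmul_mul_of_map_mul {R : Type*} [CommSemiring R] {c : ArithmeticFunction R}
    (hc : ∀ m n, c (m * n) = c m * c n) (f g : ArithmeticFunction R) :
    c.pmul (f * g) = c.pmul f * c.pmul g := by
  ext n
  rw [pmul_apply, mul_apply, mul_apply, Finset.mul_sum]
  refine Finset.sum_congr rfl fun x hx => ?_
  rw [← (Nat.mem_divisorsAntidiagonal.1 hx).1, hc, pmul_apply, pmul_apply, mul_mul_mul_comm]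

open Classical in
/-- The indicator function of a set of positive integers: the coefficient function of
`∑_{k ∈ S} p_k[F]`. Arithmetic functions vanish at `0`, whether or not `0` is in `S`. -/
def zetaOn (S : Set ℕ) : ArithmeticFunction ℂ :=
  ⟨fun n => if n ≠ 0 ∧ n ∈ S then 1 else 0, by simp⟩

open Classical in
lemma zetaOn_apply (S : Set ℕ) (n : ℕ) : zetaOn S n = if n ≠ 0 ∧ n ∈ S then 1 else 0 := rfl

variable {q : ℕ}

lemma eq_of_mul_pow_eq_mul_pow (hq : 2 ≤ q) {x y i j : ℕ} (hx : ¬ q ∣ x) (hy : ¬ q ∣ y)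
    (h : x * q ^ i = y * q ^ j) : x = y ∧ i = j := by
  have hpow (k : ℕ) : 0 < q ^ k := pow_pos (by omega) k
  have hmult {z k : ℕ} (hz : ¬ q ∣ z) : emultiplicity q (z * q ^ k) = k := by
    refine emultiplicity_eq_of_dvd_of_not_dvd (dvd_mul_left _ _) fun hdvd => hz ?_
    rw [pow_succ', Nat.mul_dvd_mul_iff_right (hpow k)] at hdvd
    exact hdvd
  obtain rfl : i = j := by exact_mod_cast (hmult hx).symm.trans (h ▸ hmult hy)
  exact ⟨Nat.eq_of_mul_eq_mul_right (hpow i) h, rfl⟩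

/-- Every positive integer is uniquely of the form `m * q ^ k` with `q ∤ m`. -/
lemma zetaOn_not_dvd_mul_zetaOn_pow (hq : 2 ≤ q) :
    zetaOn {n | ¬ q ∣ n} * zetaOn (Set.range (q ^ ·)) = ζ := by
  classical
  ext n
  rcases eq_or_ne n 0 with rfl | hn
  · simp
  obtain ⟨k, m, hm, rfl⟩ := Nat.exists_eq_pow_mul_and_not_dvd hn q (by omega)
  obtain ⟨hqk0, hm0⟩ := mul_ne_zero_iff.1 hn
  rw [mul_apply, Finset.sum_eq_single_of_mem (m, q ^ k)
    (Nat.mem_divisorsAntidiagonal.2 ⟨mul_comm _ _, hn⟩)]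
  · rw [zetaOn_apply, zetaOn_apply, if_pos ⟨hm0, hm⟩, if_pos ⟨hqk0, k, rfl⟩, natCoe_apply,
      zeta_apply_ne hn, one_mul, Nat.cast_one]
  · rintro ⟨x, y⟩ hxy hne
    rw [Nat.mem_divisorsAntidiagonal] at hxy
    by_contra h0
    simp only [zetaOn_apply, mul_ite, mul_one, mul_zero, ne_eq, ite_eq_right_iff,
      Classical.not_imp] at h0
    obtain ⟨⟨-, j, rfl⟩, ⟨-, hx⟩, -⟩ := h0
    obtain ⟨rfl, rfl⟩ := eq_of_mul_pow_eq_mul_pow hq hx hm (hxy.1.trans (mul_comm _ _))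
    exact hne rfl

lemma zetaOn_not_dvd_pmul_moebius_mul (hq : q.Prime) :
    (zetaOn {n | ¬ q ∣ n}).pmul (μ : ArithmeticFunction ℂ) * zetaOn {n | ¬ q ∣ n} = 1 := by
  have hmul (m n : ℕ) : zetaOn {n | ¬ q ∣ n} (m * n) =
      zetaOn {n | ¬ q ∣ n} m * zetaOn {n | ¬ q ∣ n} n := by
    simp only [zetaOn_apply, Set.mem_ofPred_eq, hq.dvd_mul, mul_ne_zero_iff, not_or,
      ite_zero_mul_ite_zero, one_mul, and_and_and_comm]
  calc _ = (zetaOn {n | ¬ q ∣ n}).pmul ((μ : ArithmeticFunction ℂ) * ζ) := by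
        rw [pmul_mul_of_map_mul hmul, pmul_zeta]
    _ = 1 := by
        rw [coe_moebius_mul_coe_zeta]
        ext n
        by_cases hn : n = 1 <;> simp [zetaOn_apply, one_apply, hn, hq.one_lt.ne']

end Dirichlet

section Reindexing

variable {ι : Type} {S : Set ℕ} {F G : Series} {s : ι → ℕ+}

lemma HasPlethysticSum.hasFormalSum_of_pmul_zetaOn {a : ArithmeticFunction ℂ}
    (h : HasPlethysticSum ((zetaOn S).pmul a) F G) (hs : s.Injective)
    (hS : ∀ k : ℕ+, (k : ℕ) ∈ S ↔ k ∈ Set.range s) :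
    HasFormalSum (fun i => a (s i) • powerPleth (s i) F) G := by
  convert h.comp_injective hs fun k hk => ?_ using 3 with i
  · simp [zetaOn_apply, hS]
  · simp [zetaOn_apply, mt (hS k).1 hk]

lemma HasPlethysticSum.hasFormalSum_of_zetaOn (h : HasPlethysticSum (zetaOn S) F G)
    (hs : s.Injective) (hS : ∀ k : ℕ+, (k : ℕ) ∈ S ↔ k ∈ Set.range s) :
    HasFormalSum (fun i => powerPleth (s i) F) G := by
  rw [← pmul_zeta (zetaOn S)] at h
  simpa using h.hasFormalSum_of_pmul_zetaOn hs hS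

lemma coe_two_mul_sub_one (k : ℕ+) : ((2 * k - 1 : ℕ+) : ℕ) = 2 * (k : ℕ) - 1 := by
  have hk : (1 : ℕ+) < 2 * k := by
    rw [← PNat.coe_lt_coe, PNat.mul_coe]
    exact Nat.lt_of_lt_of_le one_lt_two (Nat.le_mul_of_pos_right 2 k.pos)
  rw [PNat.sub_coe, if_pos hk]
  rfl

lemma two_mul_sub_one_injective : Function.Injective fun k : ℕ+ => 2 * k - 1 := by
  intro k l hkl
  have hkl' : 2 * (k : ℕ) - 1 = 2 * (l : ℕ) - 1 := by
    simpa only [coe_two_mul_sub_one] using congrArg PNat.val hkl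
  have hk := k.pos
  have hl := l.pos
  exact PNat.coe_injective (by omega)

lemma not_two_dvd_iff_mem_range (k : ℕ+) :
    ¬ 2 ∣ (k : ℕ) ↔ k ∈ Set.range fun i : ℕ+ => 2 * i - 1 := by
  constructor
  · refine fun hk => ⟨⟨(k + 1) / 2, by omega⟩, PNat.coe_injective ?_⟩
    refine (coe_two_mul_sub_one _).trans ?_
    rw [PNat.mk_coe]
    omega
  · rintro ⟨i, rfl⟩
    rw [coe_two_mul_sub_one]
    have hi := i.pos
    omega

end Reindexing

section LogSeries

/-- `-log (1 - p_1) = ∑_{n ≥ 1} p_1 ^ n / n`, from which `Lie`, `Conj` and `Lie^{(q)}` are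
obtained by plethystic sums. -/
def logSeries : Series :=
  formalSum fun n : ℕ+ => ((n : ℕ) : ℂ)⁻¹ • powerSum 1 ^ (n : ℕ)

lemma isHomogeneous_powerSum_pow (k m : ℕ) : (powerSum k ^ m).IsHomogeneous (m * k) := by
  have h : ((Multiset.replicate m k).map powerSum).prod.IsHomogeneous _ :=
    isHomogeneous_prod_powerSum (Multiset.replicate m k)
  rwa [Multiset.map_replicate, Multiset.prod_replicate, Multiset.sum_replicate, smul_eq_mul] at h

lemma isHomogeneous_logSeries_term (n : ℕ+) :
    (((n : ℕ) : ℂ)⁻¹ • powerSum 1 ^ (n : ℕ)).IsHomogeneous n := by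
  have h : (((n : ℕ) : ℂ)⁻¹ • powerSum 1 ^ (n : ℕ)).IsHomogeneous ((n : ℕ) * 1) :=
    isHomogeneous_smul _ (isHomogeneous_powerSum_pow 1 n)
  rwa [mul_one] at h

lemma constantCoeff_logSeries : constantCoeff logSeries = 0 :=
  constantCoeff_formalSum_of_isHomogeneous isHomogeneous_logSeries_term

lemma coeff_powerPleth_logSeries (k n : ℕ+) {d : ℕ →₀ ℕ} (hd : d.degree = k * n) :
    coeff d (powerPleth k logSeries) = ((n : ℕ) : ℂ)⁻¹ * coeff d (powerSum k ^ (n : ℕ)) := by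
  have hpow : powerSum k ^ (n : ℕ) = powerPleth k (powerSum 1 ^ (n : ℕ)) := by
    rw [powerPleth, map_pow, ← powerPleth, powerPleth_powerSum, mul_one]
  rw [hpow]
  by_cases h : ∃ e : ℕ →₀ ℕ, (k : ℕ) • e = d
  · obtain ⟨e, rfl⟩ := h
    have he : e.degree = n := by simpa using hd
    rw [coeff_smul_powerPleth, coeff_smul_powerPleth, logSeries,
      coeff_formalSum_of_isHomogeneous isHomogeneous_logSeries_term he, coeff_smul]
  · push Not at h
    rw [coeff_powerPleth_eq_zero _ h, coeff_powerPleth_eq_zero _ h, mul_zero]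

lemma hasPlethysticSum_logSeries {a : ArithmeticFunction ℂ} {f : ℕ+ → Series}
    (hf : ∀ n : ℕ+, f n =
      ((n : ℕ) : ℂ)⁻¹ • ∑ k ∈ (n : ℕ).divisors, (k * a k) • powerSum k ^ ((n : ℕ) / k)) :
    HasPlethysticSum a logSeries (formalSum f) := by
  have hhom (n : ℕ+) : (f n).IsHomogeneous n := by
    rw [hf]
    refine isHomogeneous_smul _ (isHomogeneous_sum_smul _ fun k hk => ?_)
    have h : (powerSum k ^ ((n : ℕ) / k)).IsHomogeneous ((n : ℕ) / k * k) :=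
      isHomogeneous_powerSum_pow k _
    rwa [Nat.div_mul_cancel (Nat.dvd_of_mem_divisors hk)] at h
  refine (hasPlethysticSum_iff constantCoeff_logSeries).2 fun d => ?_
  rcases d.degree.eq_zero_or_pos with hd | hd
  · rw [(Finsupp.degree_eq_zero_iff d).1 hd]
    simpa using constantCoeff_formalSum_of_isHomogeneous hhom
  obtain ⟨n, hn⟩ : ∃ n : ℕ+, d.degree = n := ⟨⟨_, hd⟩, rfl⟩
  rw [coeff_formalSum_of_isHomogeneous hhom hn, hf, coeff_smul, map_sum, Finset.mul_sum, hn]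
  refine Finset.sum_congr rfl fun k hk => ?_
  obtain ⟨m, hm⟩ := Nat.dvd_of_mem_divisors hk
  have hkm : k * m ≠ 0 := hm ▸ n.ne_zero
  lift k to ℕ+ using Nat.pos_of_ne_zero (left_ne_zero_of_mul hkm)
  lift m to ℕ+ using Nat.pos_of_ne_zero (right_ne_zero_of_mul hkm)
  rw [PNat.coe_toPNat', coeff_powerPleth_logSeries k m (hn.trans hm), hm,
    Nat.mul_div_cancel_left _ k.pos, coeff_smul]
  push_cast
  field_simp

end LogSeries

section Characters

variable {k G H : Type*} [Field k] [Group G] [Group H]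

lemma trace_coinvariants_map [Fintype G] {V : Type*} [AddCommGroup V] [Module k V]
    [FiniteDimensional k V] (hG : (Fintype.card G : k) ≠ 0) (ρ : Representation k G V)
    (T : Representation.IntertwiningMap ρ ρ) :
    LinearMap.trace k _ (Representation.Coinvariants.map ρ ρ T) =
      (Fintype.card G : k)⁻¹ * ∑ g : G, LinearMap.trace k V (ρ g ∘ₗ T.toLinearMap) := by
  let π : V →ₗ[k] ρ.Coinvariants := Representation.Coinvariants.mk ρ
  let s : ρ.Coinvariants →ₗ[k] V :=
    (Fintype.card G : k)⁻¹ • Representation.Coinvariants.lift ρ ρ.norm ρ.norm_comp_self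
  have hs : π ∘ₗ s = LinearMap.id := by
    refine Representation.Coinvariants.hom_ext (LinearMap.ext fun v => ?_)
    simp [π, s, Representation.norm, ← Nat.cast_smul_eq_nsmul k, inv_smul_smul₀ hG]
  calc LinearMap.trace k _ (Representation.Coinvariants.map ρ ρ T)
      = LinearMap.trace k _ ((π ∘ₗ T.toLinearMap) ∘ₗ s) := by
        rw [show π ∘ₗ T.toLinearMap = Representation.Coinvariants.map ρ ρ T ∘ₗ π from rfl,
          LinearMap.comp_assoc, hs, LinearMap.comp_id]
    _ = LinearMap.trace k V (s ∘ₗ π ∘ₗ T.toLinearMap) := LinearMap.trace_comp_comm' _ _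
    _ = LinearMap.trace k V ((Fintype.card G : k)⁻¹ • ρ.norm ∘ₗ T.toLinearMap) := rfl
    _ = _ := by simp [Representation.norm, ← Module.End.mul_eq_comp, Finset.sum_mul]

lemma trace_eq_sum_fixed {X : Type*} [Fintype X] [DecidableEq X] (f : X → X) (L : k[X] →ₗ[k] k[X])
    (hL : ∀ x, L (MonoidAlgebra.single x 1) = MonoidAlgebra.single (f x) 1) :
    LinearMap.trace k _ L = ∑ x : X, if f x = x then 1 else 0 := by
  let b : Module.Basis X k k[X] := .ofRepr (MonoidAlgebra.coeffLinearEquiv k)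
  rw [LinearMap.trace_eq_matrix_trace k b]
  refine Finset.sum_congr rfl fun x _ => ?_
  calc LinearMap.toMatrix b b L x x
      = (L (MonoidAlgebra.single x 1)).coeff x := LinearMap.toMatrix_apply ..
    _ = (MonoidAlgebra.single (f x) (1 : k)).coeff x := by rw [hL]
    _ = if f x = x then 1 else 0 := by rw [MonoidAlgebra.coeff_single, Finsupp.single_apply]

lemma finiteDimensional_monoidAlgebra (X : Type*) [Finite X] : FiniteDimensional k k[X] :=
  Module.Finite.equiv (MonoidAlgebra.coeffLinearEquiv k).symm

lemma character_ofMulAction {X : Type*} [MulAction H X] [Fintype X] [DecidableEq X] (h : H) :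
    (Representation.ofMulAction k H X).character h = ∑ x : X, if h • x = x then 1 else 0 :=
  trace_eq_sum_fixed (h • ·) _ fun x => Representation.ofMulAction_single h x 1

lemma character_ind [Fintype G] [Fintype H] [DecidableEq H] {V : Type*} [AddCommGroup V]
    [Module k V] [FiniteDimensional k V] (hG : (Fintype.card G : k) ≠ 0) (φ : G →* H)
    (ρ : Representation k G V) (h : H) :
    (Representation.ind φ ρ).character h = (Fintype.card G : k)⁻¹ *
      ∑ g : G, ρ.character g * ∑ x : H, if x⁻¹ * h * x = φ g then 1 else 0 := by
  have := finiteDimensional_monoidAlgebra (k := k) H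
  rw [Representation.character, Representation.ind_apply, trace_coinvariants_map hG]
  refine congrArg _ (Finset.sum_congr rfl fun g _ => ?_)
  let R : k[H] →ₗ[k] k[H] := MonoidAlgebra.mapDomainLinearMap k k fun x => x * h⁻¹
  have htensor : Representation.tprod ((Representation.leftRegular k H).comp φ) ρ g ∘ₗ R.rTensor V =
      TensorProduct.map (Representation.leftRegular k H (φ g) ∘ₗ R) (ρ g) := by
    rw [LinearMap.rTensor, Representation.tprod_apply, ← TensorProduct.map_comp]
    rfl
  refine (congrArg (LinearMap.trace k _) htensor).trans ?_
  rw [LinearMap.trace_tensorProduct', mul_comm, Representation.character,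
    trace_eq_sum_fixed (fun x => φ g * (x * h⁻¹)) _ fun x => by simp [R]]
  refine congrArg _ (Fintype.sum_equiv (Equiv.inv H) _ _ fun x => if_congr ?_ rfl rfl)
  rw [Equiv.inv_apply, inv_inv, mul_inv_eq_iff_eq_mul, ← mul_assoc, mul_inv_eq_iff_eq_mul, eq_comm]

lemma card_mul_sum_smul [Fintype H] {X : Type*} [MulAction H X]
    [MulAction.IsPretransitive H X] [Fintype X] (x : X) (f : X → k) :
    Fintype.card X * ∑ h : H, f (h • x) = Fintype.card H * ∑ y : X, f y := by
  have hx (y : X) : ∑ h : H, f (h • y) = ∑ h : H, f (h • x) := by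
    obtain ⟨g, rfl⟩ := MulAction.exists_smul_eq H x y
    simpa only [Equiv.coe_mulRight, mul_smul] using
      _root_.Equiv.sum_comp (Equiv.mulRight g) fun h => f (h • x)
  calc Fintype.card X * ∑ h : H, f (h • x)
      = ∑ y : X, ∑ h : H, f (h • y) := by simp [hx]
    _ = ∑ _h : H, ∑ y : X, f y := by
        rw [Finset.sum_comm]
        exact Finset.sum_congr rfl fun _ _ => _root_.Equiv.sum_comp (MulAction.toPerm _) f
    _ = Fintype.card H * ∑ y : X, f y := by simp

lemma character_ofMulAction_eq_character_ind [CharZero k] [Finite G] [Finite H] {X : Type*}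
    [MulAction H X] [MulAction.IsPretransitive H X] [Finite X] {φ : G →* H}
    (hφ : Function.Injective φ) {x : X} (hx : φ.range = MulAction.stabilizer H x) :
    (Representation.ofMulAction k H X).character =
      (Representation.ind φ (Representation.trivial k G k)).character := by
  classical
  have := Fintype.ofFinite G
  have := Fintype.ofFinite H
  have := Fintype.ofFinite X
  ext h
  have hG : (Fintype.card G : k) ≠ 0 := Nat.cast_ne_zero.2 Fintype.card_ne_zero
  have hX : (Fintype.card X : k) ≠ 0 := Nat.cast_ne_zero.2 (Fintype.card_pos_iff.2 ⟨x⟩).ne'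
  have hH : (Fintype.card X * Fintype.card G : k) = Fintype.card H := by
    rw [← Nat.cast_mul, ← Nat.card_eq_fintype_card, ← Nat.card_eq_fintype_card,
      ← Nat.card_eq_fintype_card, ← MulAction.index_stabilizer_of_transitive H x, ← hx,
      Nat.card_congr (MonoidHom.ofInjective hφ).toEquiv, Subgroup.index_mul_card]
  have hfiber (y : H) : (∑ g : G, if y⁻¹ * h * y = φ g then (1 : k) else 0) =
      if h • y • x = y • x then 1 else 0 := by
    have hstab : h • y • x = y • x ↔ y⁻¹ * h * y ∈ φ.range := by
      rw [hx, MulAction.mem_stabilizer_iff, mul_smul, mul_smul, inv_smul_eq_iff]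
    simp only [hstab]
    split_ifs with hg
    · obtain ⟨g, hg⟩ := hg
      simp only [← hg, hφ.eq_iff, Finset.sum_ite_eq, Finset.mem_univ, if_true]
    · exact Finset.sum_eq_zero fun g _ => if_neg fun hg' => hg ⟨g, hg'.symm⟩
  have hind : (Representation.ind φ (Representation.trivial k G k)).character h =
      (Fintype.card G : k)⁻¹ * ∑ y : H, if h • y • x = y • x then 1 else 0 := by
    rw [character_ind hG, ← Fintype.sum_congr _ _ hfiber, Finset.sum_comm]
    simp [Representation.character, Representation.trivial]
  rw [character_ofMulAction, hind, eq_inv_mul_iff_mul_eq₀ hG, ← mul_right_inj' hX, ← mul_assoc, hH,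
    card_mul_sum_smul x fun z => if h • z = z then 1 else 0]

end Characters

section Frobenius

variable {α : Type} [Fintype α] [DecidableEq α]

/-- The power sum symmetric function `p_λ` indexed by the cycle type `λ` of `σ`. -/
def cyclePowerSum (σ : Equiv.Perm α) : Series :=
  ((Equiv.Perm.partition σ).parts.map powerSum).prod

lemma cyclePowerSum_conj (σ τ : Equiv.Perm α) :
    cyclePowerSum (τ * σ * τ⁻¹) = cyclePowerSum σ := by
  rw [cyclePowerSum, cyclePowerSum,
    Equiv.Perm.partition_eq_of_isConj.1 (isConj_iff.2 ⟨τ, rfl⟩ : IsConj σ (τ * σ * τ⁻¹))]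

lemma isHomogeneous_cyclePowerSum (σ : Equiv.Perm α) :
    (cyclePowerSum σ).IsHomogeneous (Fintype.card α) := by
  have h : (cyclePowerSum σ).IsHomogeneous _ := isHomogeneous_prod_powerSum _
  rwa [(Equiv.Perm.partition σ).parts_sum] at h

lemma frobChar_eq_sum_character {V : Type} [AddCommGroup V] [Module ℂ V]
    (ρ : Representation ℂ (Equiv.Perm α) V) :
    frobChar ρ = ((Fintype.card α).factorial : ℂ)⁻¹ •
      ∑ σ : Equiv.Perm α, ρ.character σ • cyclePowerSum σ :=
  rfl

lemma isHomogeneous_frobChar {V : Type} [AddCommGroup V] [Module ℂ V]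
    (ρ : Representation ℂ (Equiv.Perm α) V) : (frobChar ρ).IsHomogeneous (Fintype.card α) :=
  isHomogeneous_smul _ (isHomogeneous_sum_smul _ fun σ _ => isHomogeneous_cyclePowerSum σ)

lemma frobChar_ind {G V : Type} [Group G] [Fintype G] [AddCommGroup V] [Module ℂ V]
    [FiniteDimensional ℂ V] (φ : G →* Equiv.Perm α) (ρ : Representation ℂ G V) :
    frobChar (Representation.ind φ ρ) =
      (Fintype.card G : ℂ)⁻¹ • ∑ g : G, ρ.character g • cyclePowerSum (φ g) := by
  have hG : (Fintype.card G : ℂ) ≠ 0 := Nat.cast_ne_zero.2 Fintype.card_ne_zero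
  have hα : ((Fintype.card α).factorial : ℂ) ≠ 0 := Nat.cast_ne_zero.2 (Nat.factorial_ne_zero _)
  have hclass (g : G) : ∑ σ : Equiv.Perm α, (∑ x : Equiv.Perm α,
      if x⁻¹ * σ * x = φ g then (1 : ℂ) else 0) • cyclePowerSum σ =
      ((Fintype.card α).factorial : ℂ) • cyclePowerSum (φ g) := by
    have hx (σ x : Equiv.Perm α) : x⁻¹ * σ * x = φ g ↔ x * φ g * x⁻¹ = σ := by
      rw [mul_assoc, inv_mul_eq_iff_eq_mul, mul_inv_eq_iff_eq_mul, eq_comm]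
    simp only [Finset.sum_smul, hx, ite_smul, one_smul, zero_smul]
    rw [Finset.sum_comm]
    simp [cyclePowerSum_conj, Fintype.card_perm, Nat.cast_smul_eq_nsmul]
  calc frobChar (Representation.ind φ ρ)
      = ((Fintype.card α).factorial : ℂ)⁻¹ • (Fintype.card G : ℂ)⁻¹ • ∑ g : G,
          ρ.character g • ∑ σ : Equiv.Perm α, (∑ x : Equiv.Perm α,
            if x⁻¹ * σ * x = φ g then (1 : ℂ) else 0) • cyclePowerSum σ := by
        simp only [frobChar_eq_sum_character, character_ind hG, mul_smul, ← Finset.smul_sum,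
          Finset.sum_smul (s := (Finset.univ : Finset G))]
        rw [Finset.sum_comm]
        simp only [Finset.smul_sum]
    _ = _ := by
        simp only [hclass, smul_comm _ ((Fintype.card α).factorial : ℂ), ← Finset.smul_sum,
          smul_inv_smul₀ hα]

lemma parts_eq_replicate {n m : ℕ} (p : n.Partition) (hm : 0 < m) (h : ∀ l ∈ p.parts, l = m) :
    p.parts = Multiset.replicate (n / m) m := by
  have hp := Multiset.eq_replicate_of_mem h
  have hn := p.parts_sum
  rw [hp, Multiset.sum_replicate, smul_eq_mul] at hn
  rwa [Nat.div_eq_of_eq_mul_left hm hn.symm]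

lemma exists_pow_apply_eq_iff_dvd_of_mem_parts {σ : Equiv.Perm α} {l : ℕ}
    (hl : l ∈ (Equiv.Perm.partition σ).parts) : ∃ x, ∀ k : ℕ, (σ ^ k) x = x ↔ l ∣ k := by
  rw [Equiv.Perm.parts_partition, Multiset.mem_add] at hl
  rcases hl with hl | hl
  · obtain ⟨c, τ, rfl, hd, hc, rfl⟩ := Equiv.Perm.mem_cycleType_iff.1 hl
    obtain ⟨x, hx⟩ := hc.nonempty_support
    rw [Equiv.Perm.mem_support] at hx
    refine ⟨x, fun k => ?_⟩
    rw [hd.commute.mul_pow, Equiv.Perm.mul_apply,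
      Equiv.Perm.pow_apply_eq_self_of_apply_eq_self ((hd x).resolve_left hx),
      ← hc.pow_eq_one_iff' hx, ← orderOf_dvd_iff_pow_eq_one, hc.orderOf]
  · obtain ⟨hc, rfl⟩ := Multiset.mem_replicate.1 hl
    obtain ⟨x, hx⟩ : ∃ x, x ∉ σ.support := by
      by_contra! hx
      exact hc (by rw [Finset.eq_univ_iff_forall.2 hx, Finset.card_univ, Nat.sub_self])
    rw [Equiv.Perm.notMem_support] at hx
    exact ⟨x, fun k => iff_of_true (Equiv.Perm.pow_apply_eq_self_of_apply_eq_self hx k)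
      (one_dvd k)⟩

lemma cyclePowerSum_addLeft {A : Type} [AddGroup A] [Fintype A] [DecidableEq A] (a : A) :
    cyclePowerSum (Equiv.addLeft a : Equiv.Perm A) =
      powerSum (addOrderOf a) ^ (Fintype.card A / addOrderOf a) := by
  have hparts (l : ℕ) (hl : l ∈ (Equiv.Perm.partition (Equiv.addLeft a)).parts) :
      l = addOrderOf a := by
    obtain ⟨x, hx⟩ := exists_pow_apply_eq_iff_dvd_of_mem_parts hl
    refine Nat.dvd_right_iff_eq.1 fun k => ?_
    rw [← hx, Equiv.nsmul_addLeft, Equiv.coe_addLeft, add_eq_right,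
      addOrderOf_dvd_iff_nsmul_eq_zero]
  rw [cyclePowerSum, parts_eq_replicate _ (addOrderOf_pos a) hparts, Multiset.map_replicate,
    Multiset.prod_replicate]

end Frobenius

section FullCycle

variable (n : ℕ+)

/-- The translation `x ↦ 1 + x` of `ℤ/n`, as an `n`-cycle: the base point that identifies the
class of `n`-cycles with the cosets of `C_n`. -/
def translationCycle : FullCycle (ZMod n) :=
  ⟨Equiv.addLeft 1, Set.bijOn_univ.2 (Equiv.bijective _), fun x _ y _ => ⟨(y - x).val, by
    rw [zpow_natCast, Equiv.nsmul_addLeft]; simp⟩⟩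

instance {α : Type} [Finite α] : Finite (FullCycle α) := Subtype.finite

instance : MulAction.IsPretransitive (Equiv.Perm (ZMod n)) (FullCycle (ZMod n)) := by
  refine (MulAction.isPretransitive_iff_base (translationCycle n)).2 fun τ => ?_
  have hτ : τ.1.IsCycleOn ((Finset.univ : Finset (ZMod n)) : Set (ZMod n)) := by
    rw [Finset.coe_univ]
    exact τ.2
  have hpow (i j : ℕ) : (τ.1 ^ i) 0 = (τ.1 ^ j) 0 ↔ (i : ZMod n) = j := by
    rw [hτ.pow_apply_eq_pow_apply (Finset.mem_univ _), Finset.card_univ, ZMod.card,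
      ZMod.natCast_eq_natCast_iff]
  have hinj : Function.Injective fun a : ZMod n => (τ.1 ^ a.val) 0 := fun a b hab => by
    simpa using (hpow _ _).1 hab
  let g : Equiv.Perm (ZMod n) := Equiv.ofBijective _ (Finite.injective_iff_bijective.1 hinj)
  refine ⟨g, Subtype.ext ?_⟩
  change g * Equiv.addLeft 1 * g⁻¹ = τ.1
  rw [mul_inv_eq_iff_eq_mul]
  ext x
  change (τ.1 ^ (1 + x).val) 0 = τ.1 ((τ.1 ^ x.val) 0)
  rw [← Equiv.Perm.mul_apply, ← pow_succ', hpow]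
  simp [add_comm]

lemma cyclicHom_injective : Function.Injective (cyclicHom n) := fun a b h =>
  Multiplicative.toAdd.injective <| by simpa [cyclicHom] using DFunLike.congr_fun h (0 : ZMod n)

lemma range_cyclicHom :
    (cyclicHom n).range = MulAction.stabilizer (Equiv.Perm (ZMod n)) (translationCycle n) := by
  ext σ
  have hcomm : σ • translationCycle n = translationCycle n ↔
      σ * Equiv.addLeft 1 = Equiv.addLeft 1 * σ := by
    rw [← mul_inv_eq_iff_eq_mul]
    exact Subtype.ext_iff
  rw [MulAction.mem_stabilizer_iff, hcomm]
  constructor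
  · rintro ⟨a, rfl⟩
    exact Equiv.ext fun x => add_left_comm (a.toAdd : ZMod n) 1 x
  · intro h
    have hσ (k : ℕ) : σ (k : ZMod n) = σ 0 + k := by
      induction k with
      | zero => simp
      | succ k ih =>
        have hk : σ (1 + k) = 1 + σ k := DFunLike.congr_fun h (k : ZMod n)
        rw [Nat.cast_succ, add_comm (k : ZMod n), hk, ih, add_left_comm]
    refine ⟨.ofAdd (σ 0), Equiv.ext fun x => ?_⟩
    simpa [cyclicHom] using (hσ x.val).symm

lemma cyclicChar_zero : cyclicChar n 0 = Representation.trivial ℂ (Multiplicative (ZMod n)) ℂ := by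
  ext a
  simp [cyclicChar]

lemma frobChar_fullCycle :
    frobChar (Representation.ofMulAction ℂ (Equiv.Perm (ZMod n)) (FullCycle (ZMod n))) =
      foulkes n 0 := by
  rw [foulkes, cyclicChar_zero, frobChar_eq_sum_character, frobChar_eq_sum_character,
    character_ofMulAction_eq_character_ind (cyclicHom_injective n) (range_cyclicHom n)]

/-- For `n = k + 1` the type `ZMod n` unfolds to `Fin n`, but its instances do not. -/
lemma conjPart_eq_foulkes : conjPart n = foulkes n 0 := by
  rw [← frobChar_fullCycle]
  obtain ⟨k, rfl⟩ : ∃ k : ℕ, n = k.succPNat := ⟨n.natPred, by simp⟩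
  have hinst (i : Fintype (Fin (k + 1))) (j : DecidableEq (Fin (k + 1))) :
      conjPart k.succPNat = @frobChar _ i j _ _ _ (Representation.ofMulAction ℂ
        (Equiv.Perm (Fin (k + 1))) (FullCycle (Fin (k + 1)))) := by
    rw [conjPart]
    congr!
  exact hinst _ _

end FullCycle

section SchurPositivity

variable {α V : Type} [AddCommGroup V] [Module ℂ V]

lemma frobChar_eq_add_of_isCompl [Fintype α] [DecidableEq α] [FiniteDimensional ℂ V]
    {ρ : Representation ℂ (Equiv.Perm α) V} {W W' : Subrepresentation ρ}
    (h : IsCompl W.toSubmodule W'.toSubmodule) :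
    frobChar ρ = frobChar W.toRepresentation + frobChar W'.toRepresentation := by
  have htrace (σ : Equiv.Perm α) : LinearMap.trace ℂ V (ρ σ) =
      LinearMap.trace ℂ _ (W.toRepresentation σ) + LinearMap.trace ℂ _ (W'.toRepresentation σ) := by
    let N : Bool → Submodule ℂ V := fun b => bif b then W.toSubmodule else W'.toSubmodule
    have hN : DirectSum.IsInternal N :=
      (DirectSum.isInternal_submodule_iff_isCompl N (i := true) (j := false) (by simp)
        (by ext b; cases b <;> simp)).2 h
    have hmaps (b : Bool) : Set.MapsTo (ρ σ) (N b) (N b) := by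
      cases b
      · exact fun v hv => W'.apply_mem_toSubmodule σ hv
      · exact fun v hv => W.apply_mem_toSubmodule σ hv
    rw [LinearMap.trace_eq_sum_trace_restrict hN hmaps, Fintype.sum_bool]
    rfl
  simp only [frobChar, htrace, add_smul, Finset.sum_add_distrib, smul_add]

lemma exists_isCompl_of_not_isIrreducible {k G V : Type*} [Field k] [Group G] [Finite G]
    [NeZero (Nat.card G : k)] [AddCommGroup V] [Module k V] [Nontrivial V]
    {ρ : Representation k G V} (hρ : ¬ ρ.IsIrreducible) :
    ∃ W W' : Subrepresentation ρ, IsCompl W.toSubmodule W'.toSubmodule ∧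
      W.toSubmodule ≠ ⊥ ∧ W'.toSubmodule ≠ ⊥ := by
  have hnontrivial : Nontrivial (Subrepresentation ρ) :=
    ⟨⊥, ⊤, fun h => bot_ne_top (congrArg Subrepresentation.toSubmodule h)⟩
  obtain ⟨W, hW⟩ : ∃ W : Subrepresentation ρ, ¬ (W = ⊥ ∨ W = ⊤) := by
    by_contra! h
    exact hρ ⟨h⟩
  have hsemisimple : ρ.IsSemisimpleRepresentation :=
    (Representation.isSemisimpleRepresentation_iff_isSemisimpleModule_asModule ρ).2 inferInstance
  obtain ⟨W', hWW'⟩ := exists_isCompl W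
  refine ⟨W, W', isCompl_iff.2 ⟨disjoint_iff.2 ?_, codisjoint_iff.2 ?_⟩, fun h => hW (.inl ?_),
    fun h => hW (.inr ?_)⟩
  · exact congrArg Subrepresentation.toSubmodule hWW'.inf_eq_bot
  · exact congrArg Subrepresentation.toSubmodule hWW'.sup_eq_top
  · exact Subrepresentation.toSubmodule_injective h
  · rw [← hWW'.sup_eq_top, Subrepresentation.toSubmodule_injective (a₁ := W') (a₂ := ⊥) h,
      sup_bot_eq]

lemma frobChar_mem_closure_schurFunctions {n : ℕ} [FiniteDimensional ℂ V]
    (ρ : Representation ℂ (Equiv.Perm (Fin n)) V) :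
    frobChar ρ ∈ AddSubmonoid.closure (schurFunctions n) := by
  induction hd : Module.finrank ℂ V using Nat.strong_induction_on generalizing V with
  | _ d ih =>
  rcases subsingleton_or_nontrivial V with hV | hV
  · have htrace (σ : Equiv.Perm (Fin n)) : LinearMap.trace ℂ V (ρ σ) = 0 := by
      rw [Subsingleton.elim (ρ σ) 0, _root_.map_zero]
    simp [frobChar, htrace]
  by_cases hρ : ρ.IsIrreducible
  · exact AddSubmonoid.subset_closure ⟨V, _, _, ‹_›, ρ, hρ, rfl⟩
  obtain ⟨W, W', hWW', hW, hW'⟩ := exists_isCompl_of_not_isIrreducible hρ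
  have hdim := Submodule.finrank_add_eq_of_isCompl hWW'
  have hdimW := Nat.pos_of_ne_zero (mt Submodule.finrank_eq_zero.1 hW)
  have hdimW' := Nat.pos_of_ne_zero (mt Submodule.finrank_eq_zero.1 hW')
  rw [frobChar_eq_add_of_isCompl hWW']
  exact add_mem (ih _ (by omega) _ rfl) (ih _ (by omega) _ rfl)

lemma isHomogeneous_conjPart (n : ℕ+) : (conjPart n).IsHomogeneous n := by
  have h : (conjPart n).IsHomogeneous _ := isHomogeneous_frobChar _
  rwa [Fintype.card_fin] at h

lemma schurPositive_Conj : SchurPositive Conj := by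
  refine schurPositive_formalSum isHomogeneous_conjPart fun n => ?_
  have := finiteDimensional_monoidAlgebra (k := ℂ) (FullCycle (Fin n))
  exact frobChar_mem_closure_schurFunctions _

end SchurPositivity

section Foulkes

/-- The Ramanujan sum `c_d(r)`, the sum of the `r`-th powers of the primitive `d`-th roots of unity,
for `d ∣ n`: the roots of unity of order `d` are the `exp (2πi a / n)` with `a` of order `d` in
`ℤ/n`. -/
def ramanujanSum (n : ℕ+) (r d : ℕ) : ℂ :=
  ∑ a : ZMod n with addOrderOf a = d, ZMod.stdAddChar ((r : ZMod n) * a)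

lemma foulkes_eq_sum_ramanujanSum (n : ℕ+) (r : ℕ) :
    foulkes n r = ((n : ℕ) : ℂ)⁻¹ • ∑ d ∈ (n : ℕ).divisors,
      ramanujanSum n r d • powerSum d ^ ((n : ℕ) / d) := by
  have horder (a : ZMod n) (_ : a ∈ Finset.univ) : addOrderOf a ∈ (n : ℕ).divisors :=
    Nat.mem_divisors.2 ⟨by simpa using addOrderOf_dvd_card (x := a), n.ne_zero⟩
  have hchar (a : ZMod n) :
      (cyclicChar n r).character (.ofAdd a) = ZMod.stdAddChar ((r : ZMod n) * a) := by
    change LinearMap.trace ℂ ℂ (ZMod.stdAddChar ((r : ZMod n) * a) • LinearMap.id) = _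
    simp
  calc foulkes n r
      = ((n : ℕ) : ℂ)⁻¹ • ∑ a : ZMod n, ZMod.stdAddChar ((r : ZMod n) * a) •
          cyclePowerSum (Equiv.addLeft a : Equiv.Perm (ZMod n)) := by
        rw [foulkes, frobChar_ind, Fintype.card_multiplicative, ZMod.card]
        refine congrArg _ (Fintype.sum_equiv Multiplicative.toAdd _ _ fun a => ?_)
        rw [← hchar]
        rfl
    _ = _ := by
        rw [← Finset.sum_fiberwise_of_maps_to horder]
        refine congrArg _ (Finset.sum_congr rfl fun d _ => ?_)
        rw [ramanujanSum, Finset.sum_smul]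
        refine Finset.sum_congr rfl fun a ha => ?_
        rw [cyclePowerSum_addLeft, (Finset.mem_filter.1 ha).2, ZMod.card]

lemma card_filter_nsmul_eq_zero {A : Type*} [AddGroup A] [IsAddCyclic A] [Fintype A]
    [DecidableEq A] {d : ℕ} (hd : d ∣ Fintype.card A) :
    (Finset.univ.filter fun a : A => d • a = 0).card = d := by
  have hd0 : d ≠ 0 := ne_zero_of_dvd_ne_zero Fintype.card_ne_zero hd
  rw [← sum_card_addOrderOf_eq_card_nsmul_eq_zero hd0]
  calc _ = ∑ e ∈ d.divisors, e.totient := Finset.sum_congr (by ext; simp [hd0]) fun e he =>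
        IsAddCyclic.card_addOrderOf_eq_totient <|
          (Nat.dvd_of_mem_divisors (by simpa [hd0] using he)).trans hd
    _ = d := Nat.sum_totient d

lemma sum_stdAddChar_filter_nsmul_eq_zero {n d : ℕ} [NeZero n] (r : ℕ) (hd : d ∣ n) :
    ∑ a : ZMod n with d • a = 0, ZMod.stdAddChar ((r : ZMod n) * a) =
      if d ∣ r then (d : ℂ) else 0 := by
  split_ifs with hr
  · have hone (a : ZMod n) (ha : a ∈ Finset.univ.filter fun a : ZMod n => d • a = 0) :
        ZMod.stdAddChar ((r : ZMod n) * a) = (1 : ℂ) := by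
      obtain ⟨m, rfl⟩ := hr
      rw [← nsmul_eq_mul, mul_comm, mul_nsmul', (Finset.mem_filter.1 ha).2, smul_zero,
        AddChar.map_zero_eq_one]
    rw [Finset.sum_congr rfl hone, Finset.sum_const, card_filter_nsmul_eq_zero (by rwa [ZMod.card]),
      nsmul_one]
  · obtain ⟨m, rfl⟩ := hd
    have hdm : (d : ZMod (d * m)) * (m : ZMod (d * m)) = 0 := by
      rw [← Nat.cast_mul, ZMod.natCast_self]
    have hne : ZMod.stdAddChar ((r : ZMod (d * m)) * (m : ZMod (d * m))) ≠ (1 : ℂ) := by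
      rw [← AddChar.map_zero_eq_one (ZMod.stdAddChar (N := d * m)),
        ZMod.injective_stdAddChar.ne_iff, ← Nat.cast_mul, Ne, ZMod.natCast_eq_zero_iff]
      exact fun h => hr (Nat.dvd_of_mul_dvd_mul_right
        (Nat.pos_of_ne_zero (right_ne_zero_of_mul (NeZero.ne (d * m)))) h)
    refine (mul_left_eq_self₀.1 ?_).resolve_left hne
    rw [Finset.mul_sum]
    exact Finset.sum_equiv (Equiv.addLeft (m : ZMod (d * m))) (by simp [mul_add, hdm])
      fun a _ => by simp [mul_add, AddChar.map_add_eq_mul]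

lemma sum_ramanujanSum {n : ℕ+} (r : ℕ) {d : ℕ} (hd : d ∣ n) :
    ∑ e ∈ d.divisors, ramanujanSum n r e = if d ∣ r then (d : ℂ) else 0 := by
  have hd0 : d ≠ 0 := ne_zero_of_dvd_ne_zero n.ne_zero hd
  have horder (a : ZMod n) (ha : a ∈ Finset.univ.filter fun a : ZMod n => d • a = 0) :
      addOrderOf a ∈ d.divisors := by
    rw [Nat.mem_divisors, addOrderOf_dvd_iff_nsmul_eq_zero]
    exact ⟨(Finset.mem_filter.1 ha).2, hd0⟩
  rw [← sum_stdAddChar_filter_nsmul_eq_zero r hd, ← Finset.sum_fiberwise_of_maps_to horder]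
  refine Finset.sum_congr rfl fun e he => ?_
  rw [ramanujanSum, Finset.filter_filter]
  refine Finset.sum_congr (Finset.filter_congr fun a _ => ?_) fun _ _ => rfl
  refine (and_iff_right_of_imp fun ha => ?_).symm
  rw [← addOrderOf_dvd_iff_nsmul_eq_zero, ha]
  exact Nat.dvd_of_mem_divisors he

/-- The arithmetic function `d ↦ μ(d) / d`: the coefficient function expressing `Lie` as a
plethystic sum over `logSeries`. -/
def moebiusDivId : ArithmeticFunction ℂ :=
  (μ : ArithmeticFunction ℂ).pdiv (ArithmeticFunction.id : ArithmeticFunction ℂ)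

lemma natCast_mul_moebiusDivId_mul (b : ArithmeticFunction ℂ) (d : ℕ) :
    d * (b * moebiusDivId) d =
      ((ArithmeticFunction.id : ArithmeticFunction ℂ).pmul b * (μ : ArithmeticFunction ℂ)) d := by
  have hid : (ArithmeticFunction.id : ArithmeticFunction ℂ).pmul moebiusDivId = μ := by
    ext n
    rcases eq_or_ne n 0 with rfl | hn
    · simp
    · have hn' : (n : ℂ) ≠ 0 := Nat.cast_ne_zero.2 hn
      simp [moebiusDivId, mul_div_cancel₀ _ hn']
  rw [← hid, ← pmul_mul_of_map_mul (by simp)]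
  simp

lemma ramanujanSum_eq {n : ℕ+} {r : ℕ} {b : ArithmeticFunction ℂ}
    (hb : ∀ d, d ∣ (n : ℕ) → b d = if d ∣ r then 1 else 0) {d : ℕ} (hd : d ∣ n) :
    ramanujanSum n r d = d * (b * moebiusDivId) d := by
  rw [natCast_mul_moebiusDivId_mul, mul_comm, mul_apply]
  refine ((sum_eq_iff_sum_mul_moebius_eq_on {e | e ∣ (n : ℕ)} fun _ _ => Dvd.dvd.trans).1
    (fun e _ he => ?_) d (Nat.pos_of_dvd_of_pos hd n.pos) hd).symm
  rw [sum_ramanujanSum r he, pmul_apply, hb e he, mul_ite, mul_one, mul_zero]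
  rfl

lemma hasPlethysticSum_formalSum_foulkes {r : ℕ+ → ℕ} {b : ArithmeticFunction ℂ}
    (hb : ∀ (n : ℕ+) (d : ℕ), d ∣ n → b d = if d ∣ r n then 1 else 0) :
    HasPlethysticSum (b * moebiusDivId) logSeries (formalSum fun n => foulkes n (r n)) := by
  refine hasPlethysticSum_logSeries fun n => ?_
  rw [foulkes_eq_sum_ramanujanSum]
  refine congrArg _ (Finset.sum_congr rfl fun d hd => ?_)
  rw [ramanujanSum_eq (hb n) (Nat.dvd_of_mem_divisors hd)]

end Foulkes

section PlethysticIdentities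

variable {q : ℕ}

lemma hasPlethysticSum_logSeries_Lie : HasPlethysticSum moebiusDivId logSeries Lie := by
  have h := hasPlethysticSum_formalSum_foulkes (r := fun _ => 1) (b := 1) fun n d _ => by
    simp [one_apply]
  rwa [one_mul] at h

lemma hasPlethysticSum_logSeries_LieVariant (hq : q.Prime) :
    HasPlethysticSum (zetaOn (Set.range (q ^ ·)) * moebiusDivId) logSeries (LieVariant q) := by
  have := Fact.mk hq
  refine hasPlethysticSum_formalSum_foulkes fun n d hd => ?_
  have hpow : d ∈ Set.range (q ^ ·) ↔ d ∣ q ^ padicValNat q n := by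
    rw [Nat.dvd_prime_pow hq]
    refine ⟨?_, fun ⟨k, _, hk⟩ => ⟨k, hk.symm⟩⟩
    rintro ⟨k, rfl⟩
    exact ⟨k, (padicValNat_dvd_iff_le n.ne_zero).1 hd, rfl⟩
  simp only [zetaOn_apply, hpow, ne_zero_of_dvd_ne_zero n.ne_zero hd, ne_eq, not_false_eq_true,
    true_and]

lemma hasPlethysticSum_logSeries_Conj : HasPlethysticSum (ζ * moebiusDivId) logSeries Conj := by
  rw [Conj, funext conjPart_eq_foulkes]
  refine hasPlethysticSum_formalSum_foulkes fun n d hd => ?_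
  simp [ne_zero_of_dvd_ne_zero n.ne_zero hd]

lemma constantCoeff_Lie : constantCoeff Lie = 0 :=
  hasPlethysticSum_logSeries_Lie.constantCoeff_eq_zero constantCoeff_logSeries

lemma hasPlethysticSum_Lie_Conj : HasPlethysticSum ζ Lie Conj :=
  hasPlethysticSum_logSeries_Lie.of_mul constantCoeff_logSeries hasPlethysticSum_logSeries_Conj

lemma hasPlethysticSum_Conj_Lie : HasPlethysticSum (μ : ArithmeticFunction ℂ) Conj Lie := by
  refine hasPlethysticSum_Lie_Conj.of_mul constantCoeff_Lie ?_
  rw [coe_moebius_mul_coe_zeta]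
  exact hasPlethysticSum_one constantCoeff_Lie

lemma hasPlethysticSum_LieVariant_Conj (hq : q.Prime) :
    HasPlethysticSum (zetaOn {n | ¬ q ∣ n}) (LieVariant q) Conj := by
  refine (hasPlethysticSum_logSeries_LieVariant hq).of_mul constantCoeff_logSeries ?_
  rw [← mul_assoc, zetaOn_not_dvd_mul_zetaOn_pow hq.two_le]
  exact hasPlethysticSum_logSeries_Conj

lemma hasPlethysticSum_Conj_LieVariant (hq : q.Prime) :
    HasPlethysticSum ((zetaOn {n | ¬ q ∣ n}).pmul μ) Conj (LieVariant q) := by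
  have hL : constantCoeff (LieVariant q) = 0 :=
    (hasPlethysticSum_logSeries_LieVariant hq).constantCoeff_eq_zero constantCoeff_logSeries
  refine (hasPlethysticSum_LieVariant_Conj hq).of_mul hL ?_
  rw [zetaOn_not_dvd_pmul_moebius_mul hq]
  exact hasPlethysticSum_one hL

lemma exists_hasPlethysticSum_Lie_Conj (hq : 2 ≤ q) :
    ∃ G, HasPlethysticSum (zetaOn (Set.range (q ^ ·))) Lie G ∧
      HasPlethysticSum (zetaOn {n | ¬ q ∣ n}) G Conj := by
  obtain ⟨G, hG⟩ := exists_hasPlethysticSum (zetaOn (Set.range (q ^ ·))) constantCoeff_Lie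
  refine ⟨G, hG, hG.of_mul constantCoeff_Lie ?_⟩
  rw [zetaOn_not_dvd_mul_zetaOn_pow hq]
  exact hasPlethysticSum_Lie_Conj

lemma isHomogeneous_foulkes (n : ℕ+) (r : ℕ) : (foulkes n r).IsHomogeneous n := by
  have h : (foulkes n r).IsHomogeneous _ := isHomogeneous_frobChar _
  rwa [ZMod.card] at h

lemma hasFormalSum_powerPleth_of_not_dvd {F G : Series}
    (h : HasPlethysticSum (zetaOn {n | ¬ q ∣ n}) F G) :
    HasFormalSum (fun n : {n : ℕ+ // ¬ q ∣ (n : ℕ)} => powerPleth n F) G :=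
  h.hasFormalSum_of_zetaOn Subtype.val_injective fun k => by simp

lemma hasFormalSum_powerPleth_pow {q : ℕ+} (hq : 2 ≤ q) {F G : Series}
    (h : HasPlethysticSum (zetaOn (Set.range ((q : ℕ) ^ ·))) F G) :
    HasFormalSum (fun k : ℕ => powerPleth (q ^ k) F) G := by
  have hq' : 2 ≤ (q : ℕ) := hq
  refine h.hasFormalSum_of_zetaOn (fun i j hij => Nat.pow_right_injective hq' ?_) fun k => ?_
  · simpa using congrArg PNat.val hij
  · simp [← PNat.coe_inj]

lemma hasFormalSum_powerPleth_odd {F G : Series}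
    (h : HasPlethysticSum (zetaOn {n | ¬ 2 ∣ n}) F G) :
    HasFormalSum (fun k : ℕ+ => powerPleth (2 * k - 1) F) G :=
  h.hasFormalSum_of_zetaOn two_mul_sub_one_injective not_two_dvd_iff_mem_range

lemma hasFormalSum_moebius_smul_powerPleth_odd {F G : Series}
    (h : HasPlethysticSum ((zetaOn {n | ¬ 2 ∣ n}).pmul μ) F G) :
    HasFormalSum (fun k : ℕ+ => μ (2 * (k : ℕ) - 1) • powerPleth (2 * k - 1) F) G := by
  have h' := h.hasFormalSum_of_pmul_zetaOn two_mul_sub_one_injective not_two_dvd_iff_mem_range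
  simpa only [coe_two_mul_sub_one, intCoe_apply, Int.cast_smul_eq_zsmul] using h'

end PlethysticIdentities

end SymPleth

end

theorem mainTheorem12 :
    -- the formal sums that define `Conj`, `Lie` and `Lie^{(q)}` make sense
    (SymPleth.HasFormalSum SymPleth.conjPart SymPleth.Conj ∧
      SymPleth.HasFormalSum SymPleth.liePart SymPleth.Lie ∧
      ∀ q : ℕ, q.Prime →
        SymPleth.HasFormalSum (SymPleth.lieVariantPart q) (SymPleth.LieVariant q)) ∧
    -- `Conj = ∑_{k ≥ 1} p_k[Lie]`, and the sum is Schur-positive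
    (SymPleth.HasFormalSum (fun k : ℕ+ => SymPleth.powerPleth k SymPleth.Lie) SymPleth.Conj ∧
      SymPleth.SchurPositive
        (SymPleth.formalSum fun k : ℕ+ => SymPleth.powerPleth k SymPleth.Lie)) ∧
    -- `Lie = ∑_{k ≥ 1} μ(k) p_k[Conj]`
    SymPleth.HasFormalSum
      (fun k : ℕ+ => ArithmeticFunction.moebius (k : ℕ) • SymPleth.powerPleth k SymPleth.Conj)
      SymPleth.Lie ∧
    -- `Conj = ∑_{k ≥ 1} p_{2k-1}[Lie^{(2)}]`, and the sum is Schur-positive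
    (SymPleth.HasFormalSum
        (fun k : ℕ+ => SymPleth.powerPleth (2 * k - 1) (SymPleth.LieVariant 2)) SymPleth.Conj ∧
      SymPleth.SchurPositive
        (SymPleth.formalSum fun k : ℕ+ =>
          SymPleth.powerPleth (2 * k - 1) (SymPleth.LieVariant 2))) ∧
    -- `Lie^{(2)} = ∑_{k ≥ 1} μ(2k-1) p_{2k-1}[Conj]`
    SymPleth.HasFormalSum
      (fun k : ℕ+ => ArithmeticFunction.moebius (2 * (k : ℕ) - 1) •
        SymPleth.powerPleth (2 * k - 1) SymPleth.Conj)
      (SymPleth.LieVariant 2) ∧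
    -- for every prime `q`, `Conj = ∑_{q ∤ n} p_n[Lie^{(q)}]`, and the sum is Schur-positive
    (∀ q : ℕ, q.Prime →
      SymPleth.HasFormalSum
        (fun n : {n : ℕ+ // ¬ q ∣ (n : ℕ)} => SymPleth.powerPleth n (SymPleth.LieVariant q))
        SymPleth.Conj ∧
      SymPleth.SchurPositive
        (SymPleth.formalSum fun n : {n : ℕ+ // ¬ q ∣ (n : ℕ)} =>
          SymPleth.powerPleth n (SymPleth.LieVariant q))) ∧
    -- for every integer `q ≥ 2`, `Conj = ∑_{q ∤ n} p_n[∑_{k ≥ 0} Lie[p_{q^k}]]`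
    (∀ q : ℕ+, 2 ≤ q →
      ∃ G : SymPleth.Series,
        SymPleth.HasFormalSum (fun k : ℕ => SymPleth.powerPleth (q ^ k) SymPleth.Lie) G ∧
        SymPleth.HasFormalSum
          (fun n : {n : ℕ+ // ¬ (q : ℕ) ∣ (n : ℕ)} => SymPleth.powerPleth n G)
          SymPleth.Conj) := by
  have hsum {ι : Type} {f : ι → SymPleth.Series} (h : SymPleth.HasFormalSum f SymPleth.Conj) :
      SymPleth.HasFormalSum f SymPleth.Conj ∧ SymPleth.SchurPositive (SymPleth.formalSum f) :=
    ⟨h, h.formalSum_eq ▸ SymPleth.schurPositive_Conj⟩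
  refine ⟨⟨?_, ?_, fun q _ => ?_⟩, hsum ?_, ?_, hsum ?_, ?_, fun q hq => hsum ?_, fun q hq => ?_⟩
  · exact SymPleth.hasFormalSum_formalSum_of_isHomogeneous SymPleth.isHomogeneous_conjPart
  · exact SymPleth.hasFormalSum_formalSum_of_isHomogeneous
      fun n => SymPleth.isHomogeneous_foulkes n _
  · exact SymPleth.hasFormalSum_formalSum_of_isHomogeneous
      fun n => SymPleth.isHomogeneous_foulkes n _
  · simpa [SymPleth.HasPlethysticSum] using SymPleth.hasPlethysticSum_Lie_Conj
  · simpa only [SymPleth.HasPlethysticSum, ArithmeticFunction.intCoe_apply,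
      Int.cast_smul_eq_zsmul] using SymPleth.hasPlethysticSum_Conj_Lie
  · exact SymPleth.hasFormalSum_powerPleth_odd
      (SymPleth.hasPlethysticSum_LieVariant_Conj Nat.prime_two)
  · exact SymPleth.hasFormalSum_moebius_smul_powerPleth_odd
      (SymPleth.hasPlethysticSum_Conj_LieVariant Nat.prime_two)
  · exact SymPleth.hasFormalSum_powerPleth_of_not_dvd (SymPleth.hasPlethysticSum_LieVariant_Conj hq)
  · obtain ⟨G, hG, hConj⟩ := SymPleth.exists_hasPlethysticSum_Lie_Conj (q := q) hq
    exact ⟨G, SymPleth.hasFormalSum_powerPleth_pow hq hG,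
      SymPleth.hasFormalSum_powerPleth_of_not_dvd hConj⟩
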